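/- Let $L$ be a countable first-order language and let $T$ be a complete, small $L$-theory with quantifier elimination (small: for every $n$ there are only countably many complete $n$-types over $\emptyset$). Let $L_0$ be $L$ together with finitely many new relation and function symbols, and let $T_0\supseteq T$ be an $L_0$-theory that is universal modulo $T$, i.e. axiomatized by those of its consequences that are equivalent, in every model of $T$, to a universal sentence. Let $N\models T$ be countable and saturated. Let $\mathrm{Exp}(N,T_0)$ be the set of all interpretations $\sigma$ on $N$ of the symbols of $L_0\smallsetminus L$ such that $(N,\sigma)\models T_0$, with the topology generated by the sets $\{\sigma : (N,\sigma)\models\phi\}$ for $\phi$ a quantifier-free $L_0$-sentence with parameters in $N$. A model $M$ of $T_0$ is existentially closed (e.c.) if every quantifier-free $L_0$-formula with parameters in $M$ that has a solution in some model of $T_0$ extending $M$ has a solution in $M$. An expansion $\sigma$ is smooth if $(N,\sigma)$ realizes every type of the form $p(x)\wedge\psi(x)$ that is finitely consistent in $(N,\sigma)$, where $x$ is a finite tuple, $p$ is a type in $L$ with finitely many parameters in $N$ and $\psi$ is a quantifier-free $L_0$-formula, possibly with parameters in $N$. Let $Y$ be the set of all $\sigma\in\mathrm{Exp}(N,T_0)$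 that are smooth and such that $(N,\sigma)$ is e.c. For $\alpha\in Y$ and a finite tuple $b$ of $N$, the 1-diagram $\mathrm{diag}_{\restriction 1}(\alpha,b)$ is the set of all $\phi(b)$ with $\phi(x)$ a universal or existential $L_0$-formula and $(N,\alpha)\models\phi(b)$. Let $D_b$ be the set of all $\mathrm{diag}_{\restriction 1}(\alpha,b)$ with $\alpha\in Y$, with the topology generated by the sets $\{\mathrm{diag}_{\restriction 1}(\alpha,b) : \alpha\in Y,\ (N,\alpha)\models\pi(b)\}$, where $\pi(x)$ ranges over the infinitary formulas $\exists y\,[p(x,y)\wedge\phi(x,y)]$ with $y$ a finite tuple, $p(x,y)$ a parameter-free type in $L$ and $\phi(x,y)$ a quantifier-free $L_0$-formula. An expansion $\alpha$ is e-atomic if $\alpha\in Y$ and, for every finite tuple $b$ of $N$, $\mathrm{diag}_{\restriction 1}(\alpha,b)$ is an isolated point of $D_b$. **Theorem.** Suppose that all e.c. models of $T_0$ have the same existential theory and that some e-atomic expansion exists in $\mathrm{Exp}(N,T_0)$. Then the set of e-atomic expansions is comeagre in $\mathrm{Exp}(N,T_0)$. In fact, $Y$ is comeagre in $\mathrm{Exp}(N,T_0)$,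 and the set of e-atomic expansions is a dense $G_\delta$ subset of $Y$ in the subspace topology. -/

import Mathlib

universe u v u' v' w

open scoped FirstOrder

namespace FirstOrder.Language

section General

variable {L : FirstOrder.Language.{u, v}}

/-- `T` has quantifier elimination: modulo `T`, every formula is equivalent to a quantifier-free
formula in the same free variables. -/
def Theory.HasQE (T : L.Theory) : Prop :=
  ∀ (n : ℕ) (φ : L.Formula (Fin n)), ∃ ψ : L.Formula (Fin n),
    BoundedFormula.IsQF ψ ∧ T ⊨ᵇ BoundedFormula.iff φ ψ

/-- `T` is small: for every `n` there are at most countably many complete parameter-free types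
in `n` variables over `T`. -/
def Theory.IsSmall (T : L.Theory) : Prop :=
  ∀ n : ℕ, Countable (T.CompleteType (Fin n))

variable (L) in
/-- Saturation of a countable structure: every set of formulas in one variable with finitely many
parameters `a` that is finitely satisfiable in `M` is realized in `M`. -/
def IsCountablySaturated (M : Type w) [L.Structure M] : Prop :=
  ∀ (m : ℕ) (a : Fin m → M) (p : Set (L.Formula (Fin m ⊕ Unit))),
    (∀ s : Finset (L.Formula (Fin m ⊕ Unit)), (s : Set (L.Formula (Fin m ⊕ Unit))) ⊆ p →
      ∃ c : M, ∀ ξ ∈ s, ξ.Realize (Sum.elim a fun _ => c)) →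
    ∃ c : M, ∀ ξ ∈ p, ξ.Realize (Sum.elim a fun _ => c)

/-- `M` is an existentially closed model of `T`: it is a model of `T`, and every quantifier-free
formula with parameters in `M` that has a solution in some model of `T` extending `M` has a
solution in `M`. Elements of `M` occurring as variables play the role of parameters. -/
def Theory.IsECModel (T : L.Theory) (M : Type w) [L.Structure M] : Prop :=
  M ⊨ T ∧
    ∀ (n : ℕ) (φ : L.Formula (M ⊕ Fin n)), BoundedFormula.IsQF φ →
      ∀ (U : Type w) [L.Structure U], U ⊨ T → ∀ f : M ↪[L] U,
        (∃ c : Fin n → U, φ.Realize (Sum.elim f c)) →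
        ∃ c : Fin n → M, φ.Realize (Sum.elim id c)

/-- All existentially closed models of `T` have the same existential theory. -/
def Theory.ECModelsShareExistentialTheory (T : L.Theory) : Prop :=
  ∀ (M₁ M₂ : Type w) [L.Structure M₁] [L.Structure M₂] [Nonempty M₁] [Nonempty M₂],
    T.IsECModel M₁ → T.IsECModel M₂ →
    ∀ φ : L.Sentence, BoundedFormula.IsExistential φ → (M₁ ⊨ φ ↔ M₂ ⊨ φ)

end General

/-! From now on `L'` is the language of the new symbols, so that the expanded language is
`L.sum L'` and an expansion of the `L`-structure `N` is an `L'`-structure on `N`. -/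

section Expansions

variable {L : FirstOrder.Language.{u, v}} {L' : FirstOrder.Language.{u', v'}}

/-- An `L`-theory seen as a theory in the expanded language. -/
abbrev liftTheory (L' : FirstOrder.Language.{u', v'}) (T : L.Theory) : (L.sum L').Theory :=
  (LHom.sumInl : L →ᴸ L.sum L').onTheory T

/-- The consequences of `T₀` that are universal modulo `T`, that is, equivalent to a universal
sentence in every model of `T`. -/
def universalPart (T : L.Theory) (T₀ : (L.sum L').Theory) : (L.sum L').Theory :=
  {φ | T₀ ⊨ᵇ φ ∧ ∃ ψ : (L.sum L').Sentence, BoundedFormula.IsUniversal ψ ∧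
    liftTheory L' T ⊨ᵇ BoundedFormula.iff φ ψ}

/-- `T₀` is universal modulo `T`: it is axiomatized by its consequences that are universal
modulo `T`. -/
def IsUniversalModulo (T : L.Theory) (T₀ : (L.sum L').Theory) : Prop :=
  ∀ φ ∈ T₀, universalPart T T₀ ⊨ᵇ φ

variable {N : Type w} [L.Structure N]

/-- The structure `(N, σ)` in the expanded language. -/
@[reducible]
def expand (σ : L'.Structure N) : (L.sum L').Structure N :=
  letI := σ
  sumStructure L L' N

/-- `(N, σ) ⊨ φ(v)`. -/
def Holds (σ : L'.Structure N) {α : Type*} (φ : (L.sum L').Formula α) (v : α → N) : Prop :=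
  letI := expand (L := L) σ
  φ.Realize v

variable (N) in
/-- The set of expansions of `N` that model `T₀`. -/
def Exp (T₀ : (L.sum L').Theory) : Type max u' v' w :=
  {σ : L'.Structure N // letI := expand (L := L) σ; N ⊨ T₀}

/-- The topology on the set of expansions, generated by the sets `[φ]_N`, where `φ` is a
quantifier-free sentence with parameters in `N` (written as a formula with variables from `N`,
each of which is interpreted as itself). -/
instance Exp.instTopologicalSpace (T₀ : (L.sum L').Theory) : TopologicalSpace (Exp N T₀) :=
  TopologicalSpace.generateFrom
    {O | ∃ φ : (L.sum L').Formula N, BoundedFormula.IsQF φ ∧ O = {σ | Holds σ.1 φ id}}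

/-- `σ` is smooth: `(N, σ)` realizes every type `p(x) ∧ ψ(x)` that is finitely consistent in
`(N, σ)`, where `p` is a type in `L` with finitely many parameters `a` and `ψ` is
quantifier-free in the expanded language. -/
def IsSmooth (σ : L'.Structure N) : Prop :=
  ∀ (m n : ℕ) (a : Fin m → N) (p : Set (L.Formula (Fin m ⊕ Fin n)))
    (ψ : (L.sum L').Formula (Fin m ⊕ Fin n)), BoundedFormula.IsQF ψ →
    (∀ s : Finset (L.Formula (Fin m ⊕ Fin n)), (s : Set (L.Formula (Fin m ⊕ Fin n))) ⊆ p →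
      ∃ c : Fin n → N, (∀ ξ ∈ s, ξ.Realize (Sum.elim a c)) ∧ Holds σ ψ (Sum.elim a c)) →
    ∃ c : Fin n → N, (∀ ξ ∈ p, ξ.Realize (Sum.elim a c)) ∧ Holds σ ψ (Sum.elim a c)

variable (N) in
/-- The set `Y` of existentially closed smooth expansions of `N`. -/
def ecSmooth (T₀ : (L.sum L').Theory) : Set (Exp N T₀) :=
  {σ | (letI := expand (L := L) σ.1; T₀.IsECModel N) ∧ IsSmooth (L := L) σ.1}

variable (L L') in
/-- An existential quasifinite formula `∃ y [p(x,y) ∧ φ(x,y)]` in the free variables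
`x = (x₁, …, xₙ)`: `p` is a parameter-free type in `L` and `φ` is a quantifier-free formula in the
expanded language. -/
structure ExistentialQuasifinite (n : ℕ) where
  /-- the length of the tuple `y` -/
  arity : ℕ
  /-- the type `p(x,y)` -/
  type : Set (L.Formula (Fin n ⊕ Fin arity))
  /-- the formula `φ(x,y)` -/
  formula : (L.sum L').Formula (Fin n ⊕ Fin arity)
  isQF : BoundedFormula.IsQF formula

/-- `(N, σ) ⊨ π(b)` for an existential quasifinite formula `π`. -/
def ExistentialQuasifinite.Realize {n : ℕ} (π : ExistentialQuasifinite L L' n)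
    (σ : L'.Structure N) (b : Fin n → N) : Prop :=
  ∃ c : Fin π.arity → N,
    (∀ ξ ∈ π.type, ξ.Realize (Sum.elim b c)) ∧ Holds σ π.formula (Sum.elim b c)

/-- The 1-diagram of `σ` at `b`: the universal and the existential formulas true of `b` in
`(N, σ)`. -/
def oneDiagram (σ : L'.Structure N) {n : ℕ} (b : Fin n → N) : Set ((L.sum L').Formula (Fin n)) :=
  {φ | (BoundedFormula.IsUniversal φ ∨ BoundedFormula.IsExistential φ) ∧ Holds σ φ b}

/-- The set `D_b` of the 1-diagrams at `b` of the expansions in `Y`. -/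
def DiagramSpace (T₀ : (L.sum L').Theory) {n : ℕ} (b : Fin n → N) : Type max u v u' v' :=
  {d : Set ((L.sum L').Formula (Fin n)) // ∃ α ∈ ecSmooth N T₀, oneDiagram α.1 b = d}

/-- The topology on `D_b`, with basic open sets
`[π(b)]_D = {diag(α, b) : α ∈ Y, (N, α) ⊨ π(b)}` for `π` existential quasifinite. -/
instance DiagramSpace.instTopologicalSpace (T₀ : (L.sum L').Theory) {n : ℕ} (b : Fin n → N) :
    TopologicalSpace (DiagramSpace T₀ b) :=
  TopologicalSpace.generateFrom
    {O | ∃ π : ExistentialQuasifinite L L' n,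
      O = {d | ∃ α ∈ ecSmooth N T₀, π.Realize α.1 b ∧ oneDiagram α.1 b = d.1}}

/-- `α` is e-atomic: it is in `Y` and, for every finite tuple `b` of `N`, its 1-diagram at `b` is an
isolated point of `D_b`. -/
def IsEAtomic {T₀ : (L.sum L').Theory} (α : Exp N T₀) : Prop :=
  ∃ hα : α ∈ ecSmooth N T₀, ∀ (n : ℕ) (b : Fin n → N),
    IsOpen ({⟨oneDiagram α.1 b, α, hα, rfl⟩} : Set (DiagramSpace T₀ b))

end Expansions

end FirstOrder.Language

-- Being e.c. and being smooth are each countable conjunctions of implications "if a certain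
-- solution is possible, then it exists in `(N, σ)`"; for smoothness this uses smallness, which
-- reduces arbitrary types to countably many complete ones. The conclusion defines an open set `E`,
-- so the implication is generic once every `σ` satisfying the premise lies in `closure E`
-- (`IsOpen.union_compl_mem_residual`). The premise yields a model `U` of `T₀` with the solution, an
-- extension of `(N, σ)` or its ultrapower, into which `N` maps `L`-elementarily. By saturation the
-- solution is copied into `N` over finitely many parameters, and back and forth between `N` and an
-- ultrapower of `U` produces an expansion of `N` that agrees with `U` on this finite data
-- (`IsPartialElementary.exists_expansion`, `Exp.exists_of_model`). Hence `Y` is comeagre.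
--
-- On `Y` the map sending `α` to its diagram at `b` is continuous, because the 1-diagram of a smooth
-- expansion decides all existential quasifinite formulas. Isolated points form an open set and
-- there are countably many `b`, so the e-atomic expansions are a Gδ in `Y` (`isGδ_isEAtomic`). For
-- density, let `σ` in `Y` satisfy a quantifier-free `θ(b)`. An e-atomic `β` has the same
-- existential theory, so by smoothness it satisfies `θ(b')` for some `b'` with the `L`-type of `b`;
-- pulling `β` back along an automorphism taking `b` to `b'` gives an e-atomic expansion satisfying
-- `θ(b)` (`dense_isEAtomic`).

universe w₁ w₂

namespace FirstOrder.Language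

open Structure TopologicalSpace

/-! ### Formulas depend on finitely many variables. -/

section FreeVariables

variable {L : Language.{u, v}} {α : Type*}

open scoped Classical in
/-- The finite set of free variables of a formula. -/
noncomputable def Formula.freeVars (φ : L.Formula α) : Set α :=
  (BoundedFormula.freeVarFinset φ : Set α)

theorem Formula.finite_freeVars (φ : L.Formula α) : φ.freeVars.Finite :=
  Finset.finite_toSet _

open scoped Classical in
/-- An enumeration of the free variables of a formula. -/
noncomputable def Formula.enumVars (φ : L.Formula α) :
    Fin (Fintype.card (BoundedFormula.freeVarFinset φ)) → α :=
  fun j => ((Fintype.equivFin _).symm j : BoundedFormula.freeVarFinset φ)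

theorem Formula.enumVars_mem (φ : L.Formula α) (j) : φ.enumVars j ∈ φ.freeVars := by
  classical
  exact Finset.mem_coe.2 (Subtype.prop _)

open scoped Classical in
/-- A formula written with an enumeration of its free variables. -/
noncomputable def Formula.toFin (φ : L.Formula α) :
    L.Formula (Fin (Fintype.card (BoundedFormula.freeVarFinset φ))) :=
  BoundedFormula.restrictFreeVar φ (Fintype.equivFin _)

theorem Formula.realize_toFin {M : Type*} [L.Structure M] (φ : L.Formula α) (v : α → M) :
    φ.toFin.Realize (v ∘ φ.enumVars) ↔ φ.Realize v := by
  classical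
  exact BoundedFormula.realize_restrictFreeVar v (fun a => by simp [Formula.enumVars])

theorem Formula.realize_congr_freeVars {M : Type*} [L.Structure M] (φ : L.Formula α) {v w : α → M}
    (h : ∀ a ∈ φ.freeVars, v a = w a) : φ.Realize v ↔ φ.Realize w := by
  rw [← φ.realize_toFin v, ← φ.realize_toFin w]
  have : v ∘ φ.enumVars = w ∘ φ.enumVars := funext fun j => h _ (φ.enumVars_mem j)
  rw [this]

end FreeVariables

/-! ### Partial elementary maps and back and forth. -/

section PartialElementary

variable {L : Language.{u, v}} {A : Type w₁} {B : Type w₂} [L.Structure A] [L.Structure B]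

variable (L) in
/-- A set of pairs is a partial elementary map (given as a relation) when corresponding tuples
satisfy the same formulas. -/
def IsPartialElementary (s : Set (A × B)) : Prop :=
  ∀ (n : ℕ) (i : Fin n → A × B), (∀ j, i j ∈ s) → ∀ ξ : L.Formula (Fin n),
    ξ.Realize (fun j => (i j).1) ↔ ξ.Realize (fun j => (i j).2)

namespace IsPartialElementary

variable {s t : Set (A × B)}

theorem mono (h : IsPartialElementary L t) (hst : s ⊆ t) : IsPartialElementary L s :=
  fun n i hi ξ => h n i (fun j => hst (hi j)) ξ

theorem realize_iff (h : IsPartialElementary L s) {α : Type*} (ξ : L.Formula α) {v : α → A}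
    {w : α → B} (hvw : ∀ a ∈ ξ.freeVars, (v a, w a) ∈ s) : ξ.Realize v ↔ ξ.Realize w := by
  rw [← ξ.realize_toFin v, ← ξ.realize_toFin w]
  exact h _ (fun j => (v (ξ.enumVars j), w (ξ.enumVars j))) (fun j => hvw _ (ξ.enumVars_mem j)) _

theorem swap (h : IsPartialElementary L s) : IsPartialElementary L (Prod.swap ⁻¹' s) :=
  fun n i hi ξ => (h n (fun j => (i j).swap) hi ξ).symm

/-- Equality is a formula, so a partial elementary relation is the graph of an injective function.
-/
theorem eq_iff (h : IsPartialElementary L s) {x y : A × B} (hx : x ∈ s) (hy : y ∈ s) :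
    x.1 = y.1 ↔ x.2 = y.2 := by
  have := h 2 ![x, y] (by intro j; fin_cases j <;> assumption)
    (Term.equal (Term.var 0) (Term.var 1))
  simpa using this

/-- The type of `e` over the second coordinates, read over the first ones, is finitely satisfiable
because existential quantification of a finite part transfers; saturation realizes it. -/
theorem exists_insert_left (hA : IsCountablySaturated L A) (hs : s.Finite)
    (h : IsPartialElementary L s) (e : B) : ∃ c : A, IsPartialElementary L (insert (c, e) s) := by
  obtain ⟨m, a, -, ha⟩ := hs.fin_param
  have key : ∀ ξ : L.Formula (Fin m), ξ.Realize (fun j => (a j).1) ↔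
      ξ.Realize (fun j => (a j).2) := h m a (fun j => ha ▸ Set.mem_range_self j)
  obtain ⟨c, hc⟩ := hA m (fun j => (a j).1)
    {ξ | ξ.Realize (Sum.elim (fun j => (a j).2) fun _ => e)} (by
      intro s' hs'
      have h1 := (key (Formula.iExs Unit (Formula.iInf fun ξ : s' => ξ.1))).2 (by
        simp only [Formula.realize_iExs, Formula.realize_iInf]
        exact ⟨fun _ => e, fun ξ => hs' ξ.2⟩)
      simp only [Formula.realize_iExs, Formula.realize_iInf] at h1
      obtain ⟨i, hi⟩ := h1
      exact ⟨i (), fun ξ hξ => hi ⟨ξ, hξ⟩⟩)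
  -- The type is complete, so negations supply the converse implication.
  have hc' : ∀ ξ : L.Formula (Fin m ⊕ Unit), ξ.Realize (Sum.elim (fun j => (a j).1) fun _ => c) ↔
      ξ.Realize (Sum.elim (fun j => (a j).2) fun _ => e) := by
    intro ξ
    refine ⟨fun h1 => ?_, fun h1 => hc ξ h1⟩
    by_contra h2
    exact (Formula.realize_not.1 (hc ξ.not (Formula.realize_not.2 h2))) h1
  refine ⟨c, fun n i hi ξ => ?_⟩
  have hex : ∀ j, ∃ r : Fin m ⊕ Unit, i j = Sum.elim a (fun _ => (c, e)) r := by
    intro j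
    rcases hi j with h1 | h1
    · exact ⟨Sum.inr (), h1⟩
    · rw [← ha] at h1
      obtain ⟨k, hk⟩ := h1
      exact ⟨Sum.inl k, hk.symm⟩
  choose r hr using hex
  have := hc' (ξ.relabel r)
  rw [Formula.realize_relabel, Formula.realize_relabel] at this
  convert this using 2
  · funext j
    rw [hr j, Function.comp_apply]
    rcases r j with k | k <;> rfl
  · funext j
    rw [hr j, Function.comp_apply]
    rcases r j with k | k <;> rfl

theorem exists_union_range_left (hA : IsCountablySaturated L A) (hs : s.Finite)
    (h : IsPartialElementary L s) {n : ℕ} (e : Fin n → B) :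
    ∃ c : Fin n → A, IsPartialElementary L (s ∪ Set.range fun j => (c j, e j)) := by
  induction n with
  | zero => exact ⟨Fin.elim0, by simpa using h⟩
  | succ n ih =>
    obtain ⟨c, hc⟩ := ih (fun j => e j.castSucc)
    obtain ⟨d, hd⟩ := exists_insert_left hA (hs.union (Set.finite_range _)) hc (e (Fin.last n))
    refine ⟨Fin.snoc c d, hd.mono ?_⟩
    rintro x (hx | ⟨j, rfl⟩)
    · exact Or.inr (Or.inl hx)
    · refine Fin.lastCases ?_ (fun j => ?_) j
      · left; simp
      · right; right; exact ⟨j, by simp⟩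

theorem exists_union_range_right (hB : IsCountablySaturated L B) (hs : s.Finite)
    (h : IsPartialElementary L s) {n : ℕ} (c : Fin n → A) :
    ∃ e : Fin n → B, IsPartialElementary L (s ∪ Set.range fun j => (c j, e j)) := by
  obtain ⟨e, he⟩ := exists_union_range_left hB
    (hs.preimage Prod.swap_injective.injOn) h.swap c
  refine ⟨e, he.swap.mono ?_⟩
  rintro x (hx | ⟨j, rfl⟩)
  · exact Or.inl (by simpa using hx)
  · exact Or.inr ⟨j, rfl⟩

/-- Back and forth: a finite partial elementary map from a countable saturated structure to a
saturated structure extends to an elementary map, whose range may moreover be closed under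
countably many prescribed existence demands. -/
theorem exists_extension [Countable A] (hA : IsCountablySaturated L A)
    (hB : IsCountablySaturated L B) (hs : s.Finite) (h : IsPartialElementary L s)
    {ι : Type*} [Countable ι] (k : ι → ℕ) (Q : ∀ i, (Fin (k i) → B) → B → Prop) :
    ∃ g : A → B, IsPartialElementary L (Set.range fun a => (a, g a)) ∧ (∀ x ∈ s, g x.1 = x.2) ∧
      ∀ i (b : Fin (k i) → A), (∃ y, Q i (g ∘ b) y) → ∃ c, Q i (g ∘ b) (g c) := by
  -- Finite partial elementary maps ordered by inclusion; an ideal meeting countably many cofinal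
  -- sets has the required map as its union.
  let P := {t : Set (A × B) // t.Finite ∧ IsPartialElementary L t}
  have hD₁ : ∀ a : A, IsCofinal {p : P | ∃ y, (a, y) ∈ p.1} := by
    rintro a ⟨t, ht, ht'⟩
    obtain ⟨e, he⟩ := ht'.exists_union_range_right hB ht (fun _ : Fin 1 => a)
    exact ⟨⟨_, ht.union (Set.finite_range _), he⟩, ⟨e 0, Or.inr ⟨0, rfl⟩⟩, Set.subset_union_left⟩
  -- A demand concerns the images of `x.2`; once these are fixed as `d`, a witness in `B` can be put
  -- into the range.
  have hD₂ : ∀ x : Σ i, (Fin (k i) → A), IsCofinal {p : P | ∃ d : Fin (k x.1) → B,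
      (∀ j, (x.2 j, d j) ∈ p.1) ∧ ((∃ y, Q x.1 d y) → ∃ c y, (c, y) ∈ p.1 ∧ Q x.1 d y)} := by
    rintro ⟨i, b⟩ ⟨t, ht, ht'⟩
    obtain ⟨d, hd⟩ := ht'.exists_union_range_right hB ht b
    by_cases hy : ∃ y, Q i d y
    · obtain ⟨y, hy⟩ := hy
      obtain ⟨c, hc⟩ := hd.exists_insert_left hA (ht.union (Set.finite_range _)) y
      exact ⟨⟨_, (ht.union (Set.finite_range _)).insert _, hc⟩,
        ⟨d, fun j => Or.inr (Or.inr ⟨j, rfl⟩), fun _ => ⟨c, y, Or.inl rfl, hy⟩⟩,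
        fun x hx => Or.inr (Or.inl hx)⟩
    · exact ⟨⟨_, ht.union (Set.finite_range _), hd⟩,
        ⟨d, fun j => Or.inr ⟨j, rfl⟩, fun h => (hy h).elim⟩, Set.subset_union_left⟩
  let D : A ⊕ (Σ i, (Fin (k i) → A)) → Order.Cofinal P :=
    Sum.elim (fun a => ⟨_, hD₁ a⟩) (fun x => ⟨_, hD₂ x⟩)
  let _ := Encodable.ofCountable (A ⊕ (Σ i, (Fin (k i) → A)))
  let I := Order.idealOfCofinals (⟨s, hs, h⟩ : P) D
  have hI := Order.cofinal_meets_idealOfCofinals (⟨s, hs, h⟩ : P) D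
  let G : Set (A × B) := {x | ∃ p ∈ I, x ∈ p.1}
  have hG : IsPartialElementary L G := by
    intro n i hi ξ
    choose p hp hip using hi
    classical
    obtain ⟨q, hq, hpq⟩ : ∃ q ∈ I, ∀ j, p j ≤ q := by
      have : Nonempty I := I.nonempty.to_subtype
      obtain ⟨z, hz⟩ := (directedOn_iff_directed.1 I.directed).finset_le
        (Finset.univ.image fun j => (⟨p j, hp j⟩ : I))
      exact ⟨z, z.2, fun j => hz _ (Finset.mem_image_of_mem _ (Finset.mem_univ j))⟩
    exact q.2.2 n i (fun j => hpq j (hip j)) ξ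
  have hg : ∀ a : A, ∃ y, (a, y) ∈ G := by
    intro a
    obtain ⟨p, ⟨y, hy⟩, hpI⟩ := hI (Sum.inl a)
    exact ⟨y, p, hpI, hy⟩
  choose g hg using hg
  have hu : ∀ {a y}, (a, y) ∈ G → g a = y := fun {a y} hy => (hG.eq_iff (hg a) hy).1 rfl
  refine ⟨g, hG.mono ?_, fun x hx => hu ⟨_, Order.mem_idealOfCofinals _ D, hx⟩, fun i b hy => ?_⟩
  · rintro _ ⟨a, rfl⟩
    exact hg a
  · obtain ⟨p, ⟨d, hd, hd'⟩, hpI⟩ := hI (Sum.inr ⟨i, b⟩)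
    have hbd : g ∘ b = d := funext fun j => hu ⟨p, hpI, hd j⟩
    rw [hbd] at hy ⊢
    obtain ⟨c, y, hcy, hQ⟩ := hd' hy
    exact ⟨c, by rwa [hu ⟨p, hpI, hcy⟩]⟩

end IsPartialElementary

end PartialElementary

/-! ### Saturation of ultrapowers over `ℕ`. -/

section Ultrapower

open Filter

variable {L : Language.{u, v}} {M : Type w} [L.Structure M]

variable (M) in
/-- The ultrapower of a structure modulo a nonprincipal ultrafilter on `ℕ`. -/
abbrev NatUltrapower : Type w := ((hyperfilter ℕ : Ultrafilter ℕ) : Filter ℕ).Product fun _ => M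

namespace NatUltrapower

/-- The diagonal map into the ultrapower. -/
noncomputable def diag (x : M) : NatUltrapower M := Quotient.mk _ fun _ => x

/-- The element of the ultrapower represented by a sequence. -/
noncomputable def ofSeq (x : ℕ → M) : NatUltrapower M := Quotient.mk _ x

theorem exists_ofSeq (x : NatUltrapower M) : ∃ y, ofSeq y = x := Quotient.exists_rep x

variable [Nonempty M]

theorem realize_ofSeq {α : Type*} (φ : L.Formula α) (v : α → ℕ → M) :
    φ.Realize (fun a => ofSeq (v a)) ↔
      ∀ᶠ i in (hyperfilter ℕ : Filter ℕ), φ.Realize fun a => v a i :=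
  Ultraproduct.realize_formula_cast φ v

theorem realize_diag {α : Type*} (φ : L.Formula α) (v : α → M) :
    φ.Realize (fun a => diag (v a)) ↔ φ.Realize v := by
  refine (Ultraproduct.realize_formula_cast φ fun a _ => v a).trans ?_
  exact eventually_const

/-- The ultrapower realizes all finitely satisfiable types with countably many formulas. -/
theorem exists_realize_of_finite [Countable L.Symbols] {α β : Type*} [Countable α] [Countable β]
    (a : α → NatUltrapower M) (p : Set (L.Formula (α ⊕ β)))
    (h : ∀ s : Finset (L.Formula (α ⊕ β)), (s : Set (L.Formula (α ⊕ β))) ⊆ p →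
      ∃ c : β → NatUltrapower M, ∀ ξ ∈ s, ξ.Realize (Sum.elim a c)) :
    ∃ c : β → NatUltrapower M, ∀ ξ ∈ p, ξ.Realize (Sum.elim a c) := by
  classical
  let _ := Encodable.ofCountable (L.Formula (α ⊕ β))
  choose a' ha' using fun x => exists_ofSeq (a x)
  have los : ∀ (c : β → ℕ → M) (ξ : L.Formula (α ⊕ β)),
      ξ.Realize (Sum.elim a fun y => ofSeq (c y)) ↔
        ∀ᶠ i in (hyperfilter ℕ : Filter ℕ),
          ξ.Realize (Sum.elim (fun x => a' x i) fun y => c y i) := by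
    intro c ξ
    have e₁ : Sum.elim a (fun y => ofSeq (c y)) = fun x => ofSeq (Sum.elim a' c x) := by
      funext x
      rcases x with x | x
      · exact (ha' x).symm
      · rfl
    have e₂ : ∀ i, Sum.elim (fun x => a' x i) (fun y => c y i) = fun x => Sum.elim a' c x i := by
      intro i
      funext x
      rcases x with x | x <;> rfl
    simp only [e₁, e₂]
    exact realize_ofSeq ξ _
  -- `sat i k`: coordinate `i` can satisfy all formulas of `p` with code below `k`. Each coordinate
  -- takes the largest possible `k ≤ i`; the bound makes this maximum exist, and for each fixed
  -- formula it is harmless at almost all coordinates.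
  let sat : ℕ → ℕ → Prop := fun i k => ∃ c : β → M, ∀ ξ ∈ p, Encodable.encode ξ < k →
    ξ.Realize (Sum.elim (fun x => a' x i) c)
  have hsat : ∀ k, ∀ᶠ i in (hyperfilter ℕ : Filter ℕ), sat i k := by
    intro k
    have hfin : {ξ : L.Formula (α ⊕ β) | ξ ∈ p ∧ Encodable.encode ξ < k}.Finite :=
      Set.Finite.subset ((Set.finite_lt_nat k).preimage Encodable.encode_injective.injOn)
        fun ξ hξ => hξ.2
    obtain ⟨c, hc⟩ := h hfin.toFinset (fun ξ hξ => (by simpa using hξ : _ ∧ _).1)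
    choose c' hc' using fun y => exists_ofSeq (c y)
    have h1 : ∀ ξ ∈ hfin.toFinset, ∀ᶠ i in (hyperfilter ℕ : Filter ℕ),
        ξ.Realize (Sum.elim (fun x => a' x i) fun y => c' y i) := by
      intro ξ hξ
      rw [← los]
      have := hc ξ hξ
      rwa [← funext hc'] at this
    filter_upwards [(Filter.eventually_all_finset hfin.toFinset).2 h1] with i hi
    exact ⟨fun y => c' y i, fun ξ h2 h3 => hi ξ (by simp [h2, h3])⟩
  have hsat₀ : ∀ i, sat i 0 := fun i => ⟨fun _ => Classical.arbitrary M, fun _ _ h => by omega⟩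
  have hK : ∀ i, sat i (Nat.findGreatest (sat i) i) := fun i =>
    Nat.findGreatest_spec (Nat.zero_le i) (hsat₀ i)
  choose c hc using hK
  refine ⟨fun y => ofSeq fun i => c i y, fun ξ hξ => (los _ ξ).2 ?_⟩
  have hlarge : ∀ᶠ i in (hyperfilter ℕ : Filter ℕ), Encodable.encode ξ + 1 ≤ i :=
    Nat.hyperfilter_le_atTop (eventually_ge_atTop _)
  filter_upwards [hlarge, hsat (Encodable.encode ξ + 1)] with i h1 h2
  exact hc i ξ hξ (Nat.lt_of_succ_le (Nat.le_findGreatest h1 h2))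

theorem isCountablySaturated [Countable L.Symbols] : IsCountablySaturated L (NatUltrapower M) := by
  intro m a p hp
  obtain ⟨c, hc⟩ := exists_realize_of_finite (β := Unit) a p (fun s hs => by
    obtain ⟨c, hc⟩ := hp s hs
    exact ⟨fun _ => c, hc⟩)
  exact ⟨c (), hc⟩

end NatUltrapower

end Ultrapower

/-! ### Expansions of `N` modelled on a given structure. -/

section Expansion

variable {L : FirstOrder.Language.{u, v}} {L' : FirstOrder.Language.{u', v'}}

theorem countable_symbols_sum (hL : Countable L.Symbols) (hL' : Countable L'.Symbols) :
    Countable (L.sum L').Symbols := by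
  rw [← Cardinal.mk_le_aleph0_iff]
  change (L.sum L').card ≤ Cardinal.aleph0
  rw [card_sum]
  simp only [Cardinal.add_le_aleph0, Cardinal.lift_le_aleph0]
  exact ⟨Cardinal.mk_le_aleph0_iff.2 hL, Cardinal.mk_le_aleph0_iff.2 hL'⟩

instance countable_boundedFormula [Countable L.Symbols] {α : Type*} [Countable α] (n : ℕ) :
    Countable (L.BoundedFormula α n) :=
  Function.Injective.countable (f := fun φ => (⟨n, φ⟩ : Σ n, L.BoundedFormula α n))
    sigma_mk_injective

/-- The formula expressing that the last variable is the value of `f` at the other ones. -/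
def graphFormula {n : ℕ} (f : L.Functions n) : L.BoundedFormula Empty (n + 1) :=
  Term.bdEqual (Term.var (Sum.inr (Fin.last n)))
    (Term.func f fun i => Term.var (Sum.inr i.castSucc))

theorem realize_graphFormula {M : Type*} [L.Structure M] {n : ℕ} (f : L.Functions n)
    (x : Fin n → M) (y : M) :
    (graphFormula f).Realize default (Fin.snoc x y : _ → M) ↔ y = funMap f x := by
  simp [graphFormula, Term.realize]

variable {N : Type w} [L.Structure N]

theorem IsPartialElementary.apply_funMap {A : Type w₁} {B : Type w₂} [L.Structure A] [L.Structure B]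
    {g : A → B} (hg : IsPartialElementary L (Set.range fun a => (a, g a))) {n : ℕ}
    (f : L.Functions n) (x : Fin n → A) : g (funMap f x) = funMap f (g ∘ x) := by
  have := hg.realize_iff (α := Fin n ⊕ Unit)
    (Term.equal (Term.var (Sum.inr ())) (Term.func f fun i => Term.var (Sum.inl i)))
    (v := Sum.elim x fun _ => funMap f x) (w := g ∘ Sum.elim x fun _ => funMap f x)
    (fun a _ => ⟨_, rfl⟩)
  simp only [Formula.realize_equal, Term.realize_var, Term.realize_func, Sum.elim_inr,
    Sum.elim_inl, Function.comp_apply, true_iff] at this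
  exact this

theorem IsPartialElementary.relMap_iff {A : Type w₁} {B : Type w₂} [L.Structure A] [L.Structure B]
    {g : A → B} (hg : IsPartialElementary L (Set.range fun a => (a, g a))) {n : ℕ}
    (r : L.Relations n) (x : Fin n → A) : RelMap r (g ∘ x) ↔ RelMap r x := by
  have := hg.realize_iff (α := Fin n) (r.formula fun i => Term.var i) (v := x) (w := g ∘ x)
    (fun a _ => ⟨_, rfl⟩)
  simp only [Formula.realize_rel, Term.realize_var] at this
  exact this.symm

/-- A finite partial elementary map from a countable saturated structure to an `L₀`-structure is
elementary in the expanded language for some expansion. -/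
theorem IsPartialElementary.exists_expansion (hL : Countable L.Symbols)
    (hL' : Countable L'.Symbols) [Countable N] (hN : IsCountablySaturated L N) {U : Type w₁}
    [Nonempty U] [L.Structure U] [(L.sum L').Structure U]
    [(LHom.sumInl : L →ᴸ L.sum L').IsExpansionOn U] {s : Set (N × U)} (hs : s.Finite)
    (h : IsPartialElementary L s) :
    ∃ σ : L'.Structure N, letI := expand (L := L) σ; IsPartialElementary (L.sum L') s := by
  have := countable_symbols_sum hL hL'
  let V := NatUltrapower U
  let _ : L.Structure V := (LHom.sumInl : L →ᴸ L.sum L').reduct V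
  have hV : IsCountablySaturated L V := by
    intro m a p hp
    obtain ⟨c, hc⟩ := NatUltrapower.isCountablySaturated (L := L.sum L') (M := U) m a
      ((LHom.sumInl : L →ᴸ L.sum L').onFormula '' p) (by
        classical
        intro t ht
        obtain ⟨t', ht', rfl⟩ := Finset.subset_set_image_iff.1 ht
        obtain ⟨c, hc⟩ := hp t' ht'
        refine ⟨c, fun ξ hξ => ?_⟩
        obtain ⟨ξ', hξ', rfl⟩ := Finset.mem_image.1 hξ
        exact (LHom.realize_onFormula _ _).2 (hc ξ' hξ'))
    exact ⟨c, fun ξ hξ => (LHom.realize_onFormula (LHom.sumInl : L →ᴸ L.sum L') ξ).1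
      (hc _ ⟨ξ, hξ, rfl⟩)⟩
  let s' : Set (N × V) := (fun x => (x.1, NatUltrapower.diag x.2)) '' s
  have hs' : IsPartialElementary L s' := by
    intro n i hi ξ
    choose x hx hxi using hi
    have h1 := h n x hx ξ
    have h2 := NatUltrapower.realize_diag ((LHom.sumInl : L →ᴸ L.sum L').onFormula ξ)
      (fun j => (x j).2)
    rw [LHom.realize_onFormula, LHom.realize_onFormula] at h2
    simp only [← hxi]
    exact h1.trans h2.symm
  -- The demands are all existential formulas of the expanded language: the range of `g` is closed
  -- under the new functions and passes the Tarski–Vaught test in `V`.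
  obtain ⟨g, hg, hgs, hgQ⟩ := hs'.exists_extension hN hV (hs.image _)
    (ι := Σ n, (L.sum L').BoundedFormula Empty (n + 1)) (fun i => i.1)
    (fun i b y => i.2.Realize default (Fin.snoc b y : _ → V))
  have hclosed : ∀ {n : ℕ} (f : L'.Functions n) (x : Fin n → N), ∃ c : N,
      g c = funMap (L := L.sum L') (Sum.inr f) (g ∘ x) := by
    intro n f x
    obtain ⟨c, hc⟩ := hgQ ⟨n, graphFormula (Sum.inr f)⟩ x
      ⟨funMap (L := L.sum L') (Sum.inr f) (g ∘ x), (realize_graphFormula _ _ _).2 rfl⟩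
    exact ⟨c, (realize_graphFormula _ _ _).1 hc⟩
  choose F hF using @hclosed
  let σ : L'.Structure N :=
    { funMap := fun f x => F f x
      RelMap := fun r x => RelMap (L := L.sum L') (Sum.inr r) (g ∘ x) }
  refine ⟨σ, ?_⟩
  let _ := expand (L := L) σ
  let G : N ↪[L.sum L'] V :=
    { toFun := g
      inj' := fun x y hxy => (hg.eq_iff ⟨x, rfl⟩ ⟨y, rfl⟩).2 hxy
      map_fun' := by
        rintro n (f | f) x
        · exact hg.apply_funMap f x
        · exact hF f x
      map_rel' := by
        rintro n (r | r) x
        · exact hg.relMap_iff r x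
        · exact Iff.rfl }
  have hG : ∀ {n : ℕ} (φ : (L.sum L').Formula (Fin n)) (x : Fin n → N),
      φ.Realize (G ∘ x) ↔ φ.Realize x :=
    G.isElementary_of_exists fun n φ x a ha => hgQ ⟨n, φ⟩ x ⟨a, ha⟩
  intro n i hi ξ
  have e : (fun j => NatUltrapower.diag (i j).2) = G ∘ fun j => (i j).1 :=
    funext fun j => (hgs _ ⟨i j, hi j, rfl⟩).symm
  rw [← NatUltrapower.realize_diag ξ fun j => (i j).2, e]
  exact (hG ξ _).symm

end Expansion

/-! ### Consequences of quantifier elimination. -/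

section QuantifierElimination

variable {L : FirstOrder.Language.{u, v}} {T : L.Theory}

/-- Quantifier elimination for formulas in an arbitrary finite set of variables. -/
theorem Theory.HasQE.exists_isQF (hT : T.HasQE) {α : Type*} [Finite α] (φ : L.Formula α) :
    ∃ ψ : L.Formula α, BoundedFormula.IsQF ψ ∧ T ⊨ᵇ BoundedFormula.iff φ ψ := by
  obtain ⟨n, ⟨e⟩⟩ := Finite.exists_equiv_fin α
  obtain ⟨ψ, hψ, h⟩ := hT n (φ.relabel e)
  refine ⟨ψ.relabel e.symm, hψ.relabel _, ?_⟩
  intro M v xs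
  have := h.realize_boundedFormula M (v := v ∘ e.symm) (xs := xs)
  have hxs : xs = default := Subsingleton.elim _ _
  subst hxs
  rw [BoundedFormula.realize_iff] at this ⊢
  have h1 : (φ.relabel e).Realize (v ∘ e.symm) ↔ φ.Realize v := by
    rw [Formula.realize_relabel]; simp [Function.comp_assoc]
  have h2 : (ψ.relabel e.symm).Realize v ↔ ψ.Realize (v ∘ e.symm) := Formula.realize_relabel
  exact h1.symm.trans (this.trans h2.symm)

theorem Theory.realize_iff_of_models {M : Type*} [L.Structure M] [Nonempty M] (hM : M ⊨ T)
    {α : Type*} {φ ψ : L.Formula α} (h : T ⊨ᵇ BoundedFormula.iff φ ψ) (v : α → M) :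
    φ.Realize v ↔ ψ.Realize v := by
  have := h.realize_boundedFormula M (v := v) (xs := default)
  rwa [BoundedFormula.realize_iff] at this

/-- By quantifier elimination, embeddings between models are elementary. -/
theorem Theory.HasQE.isPartialElementary (hT : T.HasQE) {A : Type w₁} {B : Type w₂}
    [L.Structure A] [L.Structure B] [Nonempty A] [Nonempty B] (hA : A ⊨ T) (hB : B ⊨ T)
    (f : A ↪[L] B) : IsPartialElementary L (Set.range fun a => (a, f a)) := by
  intro n i hi ξ
  obtain ⟨ψ, hψ, h⟩ := hT n ξ
  rw [Theory.realize_iff_of_models hA h, Theory.realize_iff_of_models hB h]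
  have e : (fun j => (i j).2) = f ∘ fun j => (i j).1 := by
    funext j
    obtain ⟨a, ha⟩ := hi j
    simp [← ha]
  rw [e, Formula.Realize, Formula.Realize, ← hψ.realize_embedding f]
  exact iff_of_eq (congrArg _ (Subsingleton.elim _ _))

end QuantifierElimination

/-! ### Ultrapowers in the two languages. -/

section UltrapowerExpansion

variable {L : FirstOrder.Language.{u, v}} {L' : FirstOrder.Language.{u', v'}}
variable {A : Type w} [Nonempty A] [L.Structure A] [(L.sum L').Structure A]
  [(LHom.sumInl : L →ᴸ L.sum L').IsExpansionOn A]

/-- The `L`-ultrapower agrees with the `L`-reduct of the ultrapower in the expanded language, so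
that the ultrapower of `(N, σ)` can serve as the model in `Exp.exists_of_model`. -/
instance NatUltrapower.isExpansionOn :
    (LHom.sumInl : L →ᴸ L.sum L').IsExpansionOn (NatUltrapower A) where
  map_onFunction f x := by
    choose y hy using fun j => NatUltrapower.exists_ofSeq (x j)
    obtain rfl : (fun j => NatUltrapower.ofSeq (y j)) = x := funext hy
    refine (Ultraproduct.funMap_cast (L := L.sum L') _ y).trans
      (Eq.trans ?_ (Ultraproduct.funMap_cast f y).symm)
    simp only [LHom.map_onFunction]
  map_onRelation r x := by
    choose y hy using fun j => NatUltrapower.exists_ofSeq (x j)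
    obtain rfl : (fun j => NatUltrapower.ofSeq (y j)) = x := funext hy
    have h₁ := NatUltrapower.realize_ofSeq
      ((LHom.sumInl.onRelation r : (L.sum L').Relations _).formula fun j => Term.var j) y
    have h₂ := NatUltrapower.realize_ofSeq (r.formula fun j => Term.var j) y
    simp only [Formula.realize_rel, Term.realize_var, LHom.map_onRelation] at h₁ h₂
    exact propext (h₁.trans h₂.symm)

theorem NatUltrapower.isPartialElementary_diag (A : Type w) [Nonempty A] [L.Structure A] :
    IsPartialElementary L (Set.range fun a : A => (a, NatUltrapower.diag a)) := by
  intro n i hi ξ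
  have e : (fun j => (i j).2) = fun j => NatUltrapower.diag (i j).1 := by
    funext j
    obtain ⟨a, ha⟩ := hi j
    simp [← ha]
  rw [e, NatUltrapower.realize_diag]

theorem NatUltrapower.models {T : L.Theory} (h : A ⊨ T) : NatUltrapower A ⊨ T := by
  rw [Theory.model_iff] at h ⊢
  intro φ hφ
  have := (NatUltrapower.realize_diag φ (default : Empty → A)).2 (h φ hφ)
  rw [Sentence.Realize]
  convert this

theorem NatUltrapower.exists_realize_and (hL : Countable L.Symbols) (hL' : Countable L'.Symbols)
    {m n : ℕ} (a : Fin m → A) (p : Set (L.Formula (Fin m ⊕ Fin n)))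
    (ψ : (L.sum L').Formula (Fin m ⊕ Fin n))
    (h : ∀ s : Finset (L.Formula (Fin m ⊕ Fin n)), (s : Set (L.Formula (Fin m ⊕ Fin n))) ⊆ p →
      ∃ c : Fin n → A, (∀ ξ ∈ s, ξ.Realize (Sum.elim a c)) ∧ ψ.Realize (Sum.elim a c)) :
    ∃ c : Fin n → NatUltrapower A,
      (∀ ξ ∈ p, ξ.Realize (Sum.elim (fun j => NatUltrapower.diag (a j)) c)) ∧
        ψ.Realize (Sum.elim (fun j => NatUltrapower.diag (a j)) c) := by
  classical
  have := countable_symbols_sum hL hL'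
  let ι : L →ᴸ L.sum L' := LHom.sumInl
  obtain ⟨c, hc⟩ := NatUltrapower.exists_realize_of_finite (L := L.sum L')
    (fun j => NatUltrapower.diag (a j)) (insert ψ (ι.onFormula '' p)) (by
      intro t ht
      obtain ⟨s, hs, hst⟩ := Finset.subset_set_image_iff.1
        (show ((t.erase ψ : Finset _) : Set _) ⊆ ι.onFormula '' p by
          intro ξ hξ
          rw [Finset.mem_coe, Finset.mem_erase] at hξ
          exact (ht hξ.2).resolve_left hξ.1)
      obtain ⟨c, hc, hψ⟩ := h s hs
      have e : Sum.elim (fun j => NatUltrapower.diag (a j)) (fun j => NatUltrapower.diag (c j)) =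
          fun x => NatUltrapower.diag (Sum.elim a c x) := by
        funext x
        rcases x with x | x <;> rfl
      refine ⟨fun j => NatUltrapower.diag (c j), fun ξ hξ => ?_⟩
      rw [e, NatUltrapower.realize_diag]
      by_cases hξψ : ξ = ψ
      · rwa [hξψ]
      · have := Finset.mem_erase.2 ⟨hξψ, hξ⟩
        rw [← hst] at this
        obtain ⟨ξ', hξ', rfl⟩ := Finset.mem_image.1 this
        exact (LHom.realize_onFormula _ _).2 (hc ξ' hξ'))
  exact ⟨c, fun ξ hξ => (LHom.realize_onFormula ι ξ).1 (hc _ (Or.inr ⟨ξ, hξ, rfl⟩)),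
    hc _ (Or.inl rfl)⟩

end UltrapowerExpansion

/-! ### Genericity of e.c. and smooth expansions. -/

section Comeagre

variable {L : FirstOrder.Language.{u, v}} {L' : FirstOrder.Language.{u', v'}}
  {T₀ : (L.sum L').Theory} {N : Type w} [L.Structure N]

theorem holds_inf {σ : L'.Structure N} {α : Type*} {φ ψ : (L.sum L').Formula α} {v : α → N} :
    Holds σ (φ ⊓ ψ) v ↔ Holds σ φ v ∧ Holds σ ψ v :=
  letI := expand (L := L) σ
  Formula.realize_inf

theorem holds_relabel {σ : L'.Structure N} {α β : Type*} {φ : (L.sum L').Formula α} {g : α → β}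
    {v : β → N} : Holds σ (φ.relabel g) v ↔ Holds σ φ (v ∘ g) :=
  letI := expand (L := L) σ
  Formula.realize_relabel

theorem Exp.isTopologicalBasis : IsTopologicalBasis
    {O : Set (Exp N T₀) | ∃ φ : (L.sum L').Formula N, BoundedFormula.IsQF φ ∧
      O = {σ | Holds σ.1 φ id}} where
  exists_subset_inter := by
    rintro _ ⟨φ, hφ, rfl⟩ _ ⟨ψ, hψ, rfl⟩ σ hσ
    exact ⟨_, ⟨φ ⊓ ψ, hφ.inf hψ, rfl⟩, holds_inf.2 hσ, fun τ hτ => holds_inf.1 hτ⟩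
  sUnion_eq := by
    refine Set.eq_univ_of_forall fun σ => ⟨_, ⟨⊤, BoundedFormula.IsQF.top, rfl⟩, ?_⟩
    let _ := expand (L := L) σ.1
    exact Formula.realize_top.2 trivial
  eq_generateFrom := rfl

theorem Exp.isOpen_holds {α : Type*} {φ : (L.sum L').Formula α} (hφ : BoundedFormula.IsQF φ)
    (v : α → N) : IsOpen {σ : Exp N T₀ | Holds σ.1 φ v} := by
  refine Exp.isTopologicalBasis.isOpen ⟨φ.relabel v, hφ.relabel _, ?_⟩
  ext σ
  simp only [Set.mem_ofPred_eq, holds_relabel, Function.id_comp]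

theorem Exp.mem_closure {E : Set (Exp N T₀)} {σ : Exp N T₀}
    (h : ∀ θ : (L.sum L').Formula N, BoundedFormula.IsQF θ → Holds σ.1 θ id →
      ∃ τ ∈ E, Holds τ.1 θ id) : σ ∈ closure E := by
  rw [Exp.isTopologicalBasis.mem_closure_iff]
  rintro _ ⟨θ, hθ, rfl⟩ hσ
  obtain ⟨τ, hτ, hτθ⟩ := h θ hθ hσ
  exact ⟨τ, hτθ, hτ⟩

/-- The set contains the dense open set `E ∪ (closure E)ᶜ`, however complicated `P` is. It expresses
the implication from `P` to `E`. -/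
theorem _root_.IsOpen.union_compl_mem_residual {X : Type*} [TopologicalSpace X] {E P : Set X}
    (hE : IsOpen E) (hP : P ⊆ closure E) : E ∪ Pᶜ ∈ residual X := by
  refine Filter.mem_of_superset (residual_of_dense_open (s := E ∪ (closure E)ᶜ)
    (hE.union isClosed_closure.isOpen_compl) ?_)
    (Set.union_subset_union_right _ (Set.compl_subset_compl.2 hP))
  intro x
  by_cases hx : x ∈ closure E
  · exact closure_mono Set.subset_union_left hx
  · exact subset_closure (Or.inr hx)

/-- A model of `T₀` into which `N` maps elementarily in the small language can be approximated by
expansions of `N`. -/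
theorem Exp.exists_of_model (hL : Countable L.Symbols) (hL' : Countable L'.Symbols) [Countable N]
    (hN : IsCountablySaturated L N) {U : Type w₁} [Nonempty U] [L.Structure U]
    [(L.sum L').Structure U] [(LHom.sumInl : L →ᴸ L.sum L').IsExpansionOn U] (hU : U ⊨ T₀)
    {f : N → U} (hf : IsPartialElementary L (Set.range fun a => (a, f a)))
    (θ : (L.sum L').Formula N) (hθ : θ.Realize f) {m n : ℕ} (a : Fin m → N) (c : Fin n → U)
    (φ : (L.sum L').Formula (N ⊕ Fin n)) (hφ : φ.Realize (Sum.elim f c)) :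
    ∃ τ : Exp N T₀, Holds τ.1 θ id ∧ ∃ c' : Fin n → N, Holds τ.1 φ (Sum.elim id c') ∧
      ∀ ξ : L.Formula (Fin m ⊕ Fin n), ξ.Realize (Sum.elim (f ∘ a) c) →
        ξ.Realize (Sum.elim a c') := by
  -- All parameters that matter; only their images and `c` are matched with `N`.
  let F : Set N := θ.freeVars ∪ Sum.inl ⁻¹' φ.freeVars ∪ Set.range a
  have hF : F.Finite := (θ.finite_freeVars.union
    (φ.finite_freeVars.preimage Sum.inl_injective.injOn)).union (Set.finite_range a)
  let s : Set (N × U) := (fun x => (x, f x)) '' F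
  have hs : s.Finite := hF.image _
  obtain ⟨c', hc'⟩ := (hf.mono (s := s) (by rintro _ ⟨x, -, rfl⟩; exact ⟨x, rfl⟩)
    ).exists_union_range_left hN hs c
  have hfst : ∀ x ∈ F, (x, f x) ∈ s ∪ Set.range fun j => (c' j, c j) :=
    fun x hx => Or.inl ⟨x, hx, rfl⟩
  obtain ⟨σ, hσ⟩ := hc'.exists_expansion hL hL' hN (hs.union (Set.finite_range _))
  refine ⟨⟨σ, ?_⟩, ?_, c', ?_, ?_⟩
  · let _ := expand (L := L) σ
    refine ⟨fun χ hχ => (hσ.realize_iff χ (fun x => x.elim)).2 (hU.realize_of_mem χ hχ)⟩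
  · let _ := expand (L := L) σ
    exact (hσ.realize_iff θ fun x hx => hfst x (Or.inl (Or.inl hx))).2 hθ
  · let _ := expand (L := L) σ
    refine (hσ.realize_iff φ ?_).2 hφ
    rintro (x | j) hx
    · exact hfst x (Or.inl (Or.inr hx))
    · exact Or.inr ⟨j, rfl⟩
  · intro ξ hξ
    refine (hc'.realize_iff ξ ?_).2 hξ
    rintro (j | j) -
    · exact hfst _ (Or.inr ⟨j, rfl⟩)
    · exact Or.inr ⟨j, rfl⟩

/-- The existentially closed expansions form a comeagre set. -/
theorem Exp.isECModel_mem_residual (hL : Countable L.Symbols) (hL' : Countable L'.Symbols)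
    {T : L.Theory} (hT : T.HasQE) (hTT₀ : liftTheory L' T ⊆ T₀) [Countable N] [Nonempty N]
    (hNT : N ⊨ T) (hN : IsCountablySaturated L N) :
    {σ : Exp N T₀ | letI := expand (L := L) σ.1; T₀.IsECModel N} ∈ residual (Exp N T₀) := by
  have := countable_symbols_sum hL hL'
  let E : (Σ n, {φ : (L.sum L').Formula (N ⊕ Fin n) // BoundedFormula.IsQF φ}) →
    Set (Exp N T₀) := fun x => {σ | ∃ c : Fin x.1 → N, Holds σ.1 x.2.1 (Sum.elim id c)}
  let P : (Σ n, {φ : (L.sum L').Formula (N ⊕ Fin n) // BoundedFormula.IsQF φ}) →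
    Set (Exp N T₀) := fun x => {σ | letI := expand (L := L) σ.1
      ∃ (U : Type w) (_ : (L.sum L').Structure U), U ⊨ T₀ ∧ ∃ (f : N ↪[L.sum L'] U)
        (c : Fin x.1 → U), x.2.1.Realize (Sum.elim f c)}
  have h : ∀ x, E x ∪ (P x)ᶜ ∈ residual (Exp N T₀) := by
    rintro ⟨n, φ, hφ⟩
    refine IsOpen.union_compl_mem_residual ?_ ?_
    · have : E ⟨n, φ, hφ⟩ = ⋃ c : Fin n → N, {σ | Holds σ.1 φ (Sum.elim id c)} := by
        ext σ; simp [E]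
      rw [this]
      exact isOpen_iUnion fun c => Exp.isOpen_holds hφ _
    · rintro σ ⟨U, _, hU, f, c, hc⟩
      refine Exp.mem_closure fun θ hθ hσ => ?_
      let _ := expand (L := L) σ.1
      let _ : L.Structure U := (LHom.sumInl : L →ᴸ L.sum L').reduct U
      have : Nonempty U := ⟨f (Classical.arbitrary N)⟩
      have hUT : U ⊨ T := (LHom.onTheory_model (LHom.sumInl : L →ᴸ L.sum L') T).1
        (hU.mono hTT₀)
      let f' : N ↪[L] U :=
        { toFun := f
          inj' := f.injective
          map_fun' := fun g x => f.map_fun (LHom.sumInl.onFunction g) x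
          map_rel' := fun r x => f.map_rel (LHom.sumInl.onRelation r) x }
      -- The `L`-type of `c` plays no role here, hence the empty tuple `a`.
      obtain ⟨τ, hτ, c', hc', -⟩ := Exp.exists_of_model hL hL' hN hU
        (hT.isPartialElementary hNT hUT f') θ (by
          have h1 := (hθ.realize_embedding f (v := (id : N → N)) (xs := default)).2 hσ
          rw [Formula.Realize]
          convert h1
          rfl) (m := 0) Fin.elim0 c φ hc
      exact ⟨τ, ⟨c', hc'⟩, hτ⟩
  refine Filter.mem_of_superset (countable_iInter_mem.2 h) fun σ hσ => ?_
  refine ⟨σ.2, fun n φ hφ U _ hU f hc => ?_⟩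
  rcases Set.mem_iInter.1 hσ ⟨n, φ, hφ⟩ with h | h
  · exact h
  · exact (h ⟨U, _, hU, f, hc⟩).elim

/-- The formulas in the variables `Fin m ⊕ Fin n` that belong to a complete type. -/
def Theory.CompleteType.formulas {T : L.Theory} {m n : ℕ} (q : T.CompleteType (Fin (m + n))) :
    Set (L.Formula (Fin m ⊕ Fin n)) :=
  {ξ | Formula.equivSentence (ξ.relabel finSumFinEquiv) ∈ q}

theorem Theory.CompleteType.mem_formulas_typeOf {T : L.Theory} {M : Type*} [L.Structure M]
    [Nonempty M] [M ⊨ T] {m n : ℕ} (a : Fin m → M) (c : Fin n → M)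
    (ξ : L.Formula (Fin m ⊕ Fin n)) :
    ξ ∈ (T.typeOf (Sum.elim a c ∘ finSumFinEquiv.symm)).formulas ↔ ξ.Realize (Sum.elim a c) := by
  rw [Theory.CompleteType.formulas, Set.mem_ofPred_eq, Theory.CompleteType.formula_mem_typeOf,
    Formula.realize_relabel]
  simp [Function.comp_assoc]

/-- The smooth expansions form a comeagre set. -/
theorem Exp.isSmooth_mem_residual (hL : Countable L.Symbols) (hL' : Countable L'.Symbols)
    {T : L.Theory} (hT : T.IsSmall) [Countable N] [Nonempty N]
    (hNT : N ⊨ T) (hN : IsCountablySaturated L N) :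
    {σ : Exp N T₀ | IsSmooth (L := L) σ.1} ∈ residual (Exp N T₀) := by
  have := countable_symbols_sum hL hL'
  have := fun n => hT n
  -- Only complete types over `∅` are indexed, with the parameters substituted for variables;
  -- smallness makes this countable.
  let ι := Σ m n : ℕ, (Fin m → N) × T.CompleteType (Fin (m + n)) ×
    {φ : (L.sum L').Formula (Fin m ⊕ Fin n) // BoundedFormula.IsQF φ}
  let E : ι → Set (Exp N T₀) := fun ⟨m, n, a, q, ψ⟩ => {σ | ∃ c : Fin n → N,
    (∀ ξ ∈ q.formulas, ξ.Realize (Sum.elim a c)) ∧ Holds σ.1 ψ.1 (Sum.elim a c)}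
  let P : ι → Set (Exp N T₀) := fun ⟨m, n, a, q, ψ⟩ => {σ |
    ∀ s : Finset (L.Formula (Fin m ⊕ Fin n)),
      (s : Set (L.Formula (Fin m ⊕ Fin n))) ⊆ q.formulas →
      ∃ c : Fin n → N, (∀ ξ ∈ s, ξ.Realize (Sum.elim a c)) ∧ Holds σ.1 ψ.1 (Sum.elim a c)}
  have h : ∀ x, E x ∪ (P x)ᶜ ∈ residual (Exp N T₀) := by
    rintro ⟨m, n, a, q, ψ, hψ⟩
    refine IsOpen.union_compl_mem_residual ?_ ?_
    · have : E ⟨m, n, a, q, ψ, hψ⟩ = ⋃ (c : Fin n → N)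
          (_ : ∀ ξ ∈ q.formulas, ξ.Realize (Sum.elim a c)), {σ | Holds σ.1 ψ (Sum.elim a c)} := by
        ext σ; simp [E]
      rw [this]
      exact isOpen_iUnion fun c => isOpen_iUnion fun _ => Exp.isOpen_holds hψ _
    · rintro σ hσ
      refine Exp.mem_closure fun θ hθ hσθ => ?_
      let _ := expand (L := L) σ.1
      obtain ⟨c, hc, hcψ⟩ := NatUltrapower.exists_realize_and hL hL' a q.formulas ψ hσ
      obtain ⟨τ, hτ, c', hc', hξ⟩ := Exp.exists_of_model hL hL' hN
        (NatUltrapower.models (L := L.sum L') σ.2) (NatUltrapower.isPartialElementary_diag N)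
        θ ((NatUltrapower.realize_diag θ id).2 hσθ) a c (ψ.relabel (Sum.map a id)) (by
          rw [Formula.realize_relabel, Sum.elim_comp_map]
          exact hcψ)
      refine ⟨τ, ⟨c', fun ξ hξq => hξ ξ (hc ξ hξq), ?_⟩, hτ⟩
      rwa [holds_relabel, Sum.elim_comp_map] at hc'
  refine Filter.mem_of_superset (countable_iInter_mem.2 h) fun σ hσ => ?_
  intro m n a p ψ hψ hp
  let _ := expand (L := L) σ.1
  obtain ⟨c, hc, hcψ⟩ := NatUltrapower.exists_realize_and hL hL' a p ψ hp
  have : NatUltrapower N ⊨ T := NatUltrapower.models hNT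
  -- A realization of `p ∧ ψ` in the ultrapower extends `p` to a complete type `q`, and `q ∧ ψ` is
  -- still finitely consistent in `(N, σ)` by elementarity of the diagonal map.
  let q := T.typeOf (Sum.elim (fun j => NatUltrapower.diag (a j)) c ∘ finSumFinEquiv.symm)
  have hq : ∀ ξ, ξ ∈ q.formulas ↔ _ := Theory.CompleteType.mem_formulas_typeOf _ c
  rcases Set.mem_iInter.1 hσ ⟨m, n, a, q, ψ, hψ⟩ with ⟨d, hd, hdψ⟩ | h
  · exact ⟨d, fun ξ hξ => hd ξ ((hq ξ).2 (hc ξ hξ)), hdψ⟩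
  · refine (h fun s hs => ?_).elim
    let χ : (L.sum L').Formula (Fin m) := Formula.iExs (Fin n)
      ((Formula.iInf fun ξ : s => (LHom.sumInl : L →ᴸ L.sum L').onFormula ξ.1) ⊓ ψ)
    have hχ : χ.Realize a := by
      rw [← NatUltrapower.realize_diag]
      simp only [χ, Formula.realize_iExs, Formula.realize_inf, Formula.realize_iInf,
        LHom.realize_onFormula]
      exact ⟨c, fun ξ => (hq ξ).1 (hs ξ.2), hcψ⟩
    simp only [χ, Formula.realize_iExs, Formula.realize_inf, Formula.realize_iInf,
        LHom.realize_onFormula] at hχ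
    obtain ⟨i, h1, h2⟩ := hχ
    exact ⟨i, fun ξ hξ => h1 ⟨ξ, hξ⟩, h2⟩

/-- The existentially closed smooth expansions form a comeagre set. -/
theorem Exp.ecSmooth_mem_residual (hL : Countable L.Symbols) (hL' : Countable L'.Symbols)
    {T : L.Theory} (hTqe : T.HasQE) (hTsmall : T.IsSmall) (hTT₀ : liftTheory L' T ⊆ T₀)
    [Countable N] [Nonempty N] (hNT : N ⊨ T) (hN : IsCountablySaturated L N) :
    ecSmooth N T₀ ∈ residual (Exp N T₀) :=
  Filter.inter_mem (Exp.isECModel_mem_residual hL hL' hTqe hTT₀ hNT hN)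
    (Exp.isSmooth_mem_residual hL hL' hTsmall hNT hN)

end Comeagre

/-! ### Existential formulas with `L`-conditions in the matrix. -/

section Existential

variable {L : FirstOrder.Language.{u, v}} {L' : FirstOrder.Language.{u', v'}}

theorem BoundedFormula.IsExistential.exs {α : Type*} {n : ℕ} {φ : L.BoundedFormula α n}
    (h : φ.IsExistential) : BoundedFormula.IsExistential φ.exs := by
  induction n with
  | zero => exact h
  | succ n ih => exact ih h.ex

theorem BoundedFormula.IsQF.isExistential_iExs {α β : Type*} [Finite β] {φ : L.Formula (α ⊕ β)}
    (h : BoundedFormula.IsQF φ) : BoundedFormula.IsExistential (Formula.iExs β φ) :=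
  (h.relabel _).isExistential.exs

theorem BoundedFormula.IsQF.onFormula (ι : L →ᴸ L') {α : Type*} {n : ℕ} {φ : L.BoundedFormula α n}
    (h : φ.IsQF) : (ι.onBoundedFormula φ).IsQF := by
  induction h with
  | falsum => exact .falsum
  | of_isAtomic h =>
    cases h with
    | equal t₁ t₂ => exact (IsAtomic.equal _ _).isQF
    | rel R ts => exact (IsAtomic.rel _ _).isQF
  | imp _ _ h₁ h₂ => exact h₁.imp h₂

variable {N : Type w} [L.Structure N] [Nonempty N]

/-- By quantifier elimination, `∃ y [⋀ s(x,y) ∧ ψ(x,y)]` is equivalent to an existential formula. -/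
theorem exists_isExistential {T : L.Theory} (hT : T.HasQE) (hNT : N ⊨ T) {α : Type*} [Finite α]
    {k : ℕ} (s : Finset (L.Formula (α ⊕ Fin k))) {ψ : (L.sum L').Formula (α ⊕ Fin k)}
    (hψ : BoundedFormula.IsQF ψ) :
    ∃ χ : (L.sum L').Formula α, BoundedFormula.IsExistential χ ∧
      ∀ (σ : L'.Structure N) (b : α → N), Holds σ χ b ↔
        ∃ c : Fin k → N, (∀ ξ ∈ s, ξ.Realize (Sum.elim b c)) ∧ Holds σ ψ (Sum.elim b c) := by
  obtain ⟨ζ, hζ, h⟩ := hT.exists_isQF (Formula.iInf fun ξ : s => ξ.1)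
  refine ⟨Formula.iExs (Fin k) ((LHom.sumInl : L →ᴸ L.sum L').onFormula ζ ⊓ ψ),
    BoundedFormula.IsQF.isExistential_iExs ((hζ.onFormula _).inf hψ), fun σ b => ?_⟩
  let _ := expand (L := L) σ
  have hζ' := fun v : α ⊕ Fin k → N => Theory.realize_iff_of_models hNT h v
  simp only [Holds, Formula.realize_iExs, Formula.realize_inf, LHom.realize_onFormula, ← hζ',
    Formula.realize_iInf, Subtype.forall]

end Existential

/-! ### Continuity of the diagram map and the Gδ property. -/

section Diagrams

variable {L : FirstOrder.Language.{u, v}} {L' : FirstOrder.Language.{u', v'}}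
  {T₀ : (L.sum L').Theory} {N : Type w} [L.Structure N]

theorem ExistentialQuasifinite.isOpen_realize {n : ℕ} (π : ExistentialQuasifinite L L' n)
    (b : Fin n → N) : IsOpen {σ : Exp N T₀ | π.Realize σ.1 b} := by
  have : {σ : Exp N T₀ | π.Realize σ.1 b} = ⋃ (c : Fin π.arity → N)
      (_ : ∀ ξ ∈ π.type, ξ.Realize (Sum.elim b c)),
        {σ | Holds σ.1 π.formula (Sum.elim b c)} := by
    ext σ; simp [ExistentialQuasifinite.Realize]
  rw [this]
  exact isOpen_iUnion fun c => isOpen_iUnion fun _ => Exp.isOpen_holds π.isQF _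

variable [Nonempty N]

/-- The 1-diagram of a smooth expansion determines the existential quasifinite formulas. -/
theorem ExistentialQuasifinite.realize_of_oneDiagram_subset {T : L.Theory} (hT : T.HasQE)
    (hNT : N ⊨ T) {n : ℕ} {b : Fin n → N} {σ τ : L'.Structure N} (hτ : IsSmooth (L := L) τ)
    (h : oneDiagram (L := L) σ b ⊆ oneDiagram τ b) {π : ExistentialQuasifinite L L' n}
    (hπ : π.Realize σ b) : π.Realize τ b := by
  obtain ⟨c, hc, hcψ⟩ := hπ
  refine hτ n π.arity b π.type π.formula π.isQF fun s hs => ?_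
  obtain ⟨χ, hχ, hχ'⟩ := exists_isExistential (L' := L') hT hNT s π.isQF
  exact (hχ' τ b).1 (h ⟨Or.inr hχ, (hχ' σ b).2 ⟨c, fun ξ hξ => hc ξ (hs hξ), hcψ⟩⟩).2

/-- The 1-diagram at `b`, as a map from `Y` to `D_b`. -/
def ecSmooth.diagram {n : ℕ} (b : Fin n → N) (α : ecSmooth N T₀) : DiagramSpace T₀ b :=
  ⟨oneDiagram α.1.1 b, α.1, α.2, rfl⟩

/-- A basic open set only asks that some `β` in `Y` with the given diagram satisfy `π`. By
smoothness every `α` in `Y` with that diagram then satisfies `π`, so the preimage is the open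
condition `π.Realize α b`. -/
theorem ecSmooth.continuous_diagram {T : L.Theory} (hT : T.HasQE) (hNT : N ⊨ T) {n : ℕ}
    (b : Fin n → N) : Continuous (ecSmooth.diagram (T₀ := T₀) b) := by
  refine continuous_generateFrom_iff.2 ?_
  rintro _ ⟨π, rfl⟩
  convert (π.isOpen_realize b).preimage (continuous_subtype_val (p := (· ∈ ecSmooth N T₀))) using 1
  ext α
  constructor
  · rintro ⟨β, hβ, hπ, h⟩
    exact π.realize_of_oneDiagram_subset hT hNT α.2.2 h.subset hπ
  · intro hπ
    exact ⟨α.1, α.2, hπ, rfl⟩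

theorem isGδ_isEAtomic {T : L.Theory} (hT : T.HasQE) (hNT : N ⊨ T) [Countable N] :
    IsGδ {α : ecSmooth N T₀ | IsEAtomic α.1} := by
  have h : {α : ecSmooth N T₀ | IsEAtomic α.1} = ⋂ x : Σ n, (Fin n → N),
      ecSmooth.diagram x.2 ⁻¹' {d | IsOpen {d}} := by
    ext α
    simp only [Set.mem_iInter, Sigma.forall]
    exact ⟨fun ⟨_, h⟩ => h, fun h => ⟨α.2, h⟩⟩
  rw [h]
  refine IsGδ.iInter_of_isOpen fun x => IsOpen.preimage (ecSmooth.continuous_diagram hT hNT x.2) ?_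
  have : {d : DiagramSpace T₀ x.2 | IsOpen {d}} =
      ⋃ (d : DiagramSpace T₀ x.2) (_ : IsOpen {d}), {d} := by
    ext d
    simp
  rw [this]
  exact isOpen_iUnion fun d => isOpen_iUnion fun hd => hd

end Diagrams

/-! ### Transport of expansions along `L`-isomorphisms. -/

section Pullback

variable {L : FirstOrder.Language.{u, v}} {L' : FirstOrder.Language.{u', v'}}
  {T₀ : (L.sum L').Theory} {M : Type w} {N : Type w} [L.Structure M] [L.Structure N]

/-- The pullback of an expansion along an isomorphism. -/
@[reducible]
def pullStructure (g : M ≃[L] N) (σ : L'.Structure N) : L'.Structure M where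
  funMap f x := g.symm (funMap f (g ∘ x))
  RelMap r x := RelMap r (g ∘ x)

/-- The isomorphism from the pullback of an expansion to the expansion. -/
def pullEquiv (g : M ≃[L] N) (σ : L'.Structure N) :
    letI := expand (L := L) σ
    letI := expand (L := L) (pullStructure g σ)
    M ≃[L.sum L'] N :=
  letI := expand (L := L) σ
  letI := expand (L := L) (pullStructure g σ)
  { toEquiv := g.toEquiv
    map_fun' := by
      rintro n (f | f) x
      · exact g.map_fun f x
      · exact g.apply_symm_apply _
    map_rel' := by
      rintro n (r | r) x
      · exact g.map_rel r x
      · exact Iff.rfl }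

theorem holds_pullStructure (g : M ≃[L] N) (σ : L'.Structure N) {α : Type*}
    (φ : (L.sum L').Formula α) (v : α → M) :
    Holds (pullStructure g σ) φ v ↔ Holds σ φ (g ∘ v) := by
  let _ := expand (L := L) σ
  let _ := expand (L := L) (pullStructure g σ)
  exact (StrongHomClass.realize_formula (pullEquiv g σ) φ).symm

theorem realize_elim_comp (g : M ≃[L] N) {α β : Type*} (ξ : L.Formula (α ⊕ β)) (a : α → M)
    (c : β → M) : ξ.Realize (Sum.elim (g ∘ a) (g ∘ c)) ↔ ξ.Realize (Sum.elim a c) := by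
  rw [← Sum.comp_elim, StrongHomClass.realize_formula]

theorem holds_elim_comp (g : M ≃[L] N) (σ : L'.Structure N) {α β : Type*}
    (ψ : (L.sum L').Formula (α ⊕ β)) (a : α → M) (c : β → M) :
    Holds σ ψ (Sum.elim (g ∘ a) (g ∘ c)) ↔ Holds (pullStructure g σ) ψ (Sum.elim a c) := by
  rw [holds_pullStructure, Sum.comp_elim]

/-- This shape covers the premise and the conclusion of smoothness as well as quasifinite formulas.
-/
theorem exists_realize_pullStructure (g : M ≃[L] N) (σ : L'.Structure N) {α β : Type*}
    (p : Set (L.Formula (α ⊕ β))) (ψ : (L.sum L').Formula (α ⊕ β)) (a : α → M) :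
    (∃ c : β → M, (∀ ξ ∈ p, ξ.Realize (Sum.elim a c)) ∧
        Holds (pullStructure g σ) ψ (Sum.elim a c)) ↔
      ∃ c : β → N, (∀ ξ ∈ p, ξ.Realize (Sum.elim (g ∘ a) c)) ∧
        Holds σ ψ (Sum.elim (g ∘ a) c) := by
  constructor
  · rintro ⟨c, hc, hψ⟩
    exact ⟨g ∘ c, fun ξ hξ => (realize_elim_comp g ξ a c).2 (hc ξ hξ),
      (holds_elim_comp g σ ψ a c).2 hψ⟩
  · rintro ⟨c, hc, hψ⟩
    obtain ⟨c, rfl⟩ : ∃ c' : β → M, g ∘ c' = c := ⟨g.symm ∘ c, by ext; simp⟩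
    exact ⟨c, fun ξ hξ => (realize_elim_comp g ξ a c).1 (hc ξ hξ),
      (holds_elim_comp g σ ψ a c).1 hψ⟩

theorem IsSmooth.pullStructure (g : M ≃[L] N) {σ : L'.Structure N} (h : IsSmooth (L := L) σ) :
    IsSmooth (L := L) (pullStructure g σ) := by
  intro m n a p ψ hψ hp
  rw [exists_realize_pullStructure]
  exact h m n (g ∘ a) p ψ hψ fun s hs =>
    (exists_realize_pullStructure g σ (s : Set _) ψ a).1 (hp s hs)

/-- The pullback of an expansion satisfying `T₀`. -/
def Exp.pull (g : M ≃[L] N) (σ : Exp N T₀) : Exp M T₀ :=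
  ⟨pullStructure g σ.1, by
    let _ := expand (L := L) σ.1
    let _ := expand (L := L) (pullStructure g σ.1)
    have h : N ⊨ T₀ := σ.2
    exact (StrongHomClass.theory_model (pullEquiv g σ.1).symm)⟩

theorem Exp.isECModel_pull (g : M ≃[L] N) (σ : L'.Structure N)
    (h : letI := expand (L := L) σ; T₀.IsECModel N) :
    letI := expand (L := L) (pullStructure g σ); T₀.IsECModel M := by
  refine ⟨(Exp.pull g ⟨σ, h.1⟩).2, fun n φ hφ U _ hU f => ?_⟩
  rintro ⟨c, hc⟩
  let _ := expand (L := L) σ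
  let _ := expand (L := L) (pullStructure g σ)
  obtain ⟨d, hd⟩ := h.2 n (φ.relabel (Sum.map g id)) (BoundedFormula.IsQF.relabel hφ _) U hU
    (f.comp (pullEquiv g σ).symm.toEmbedding) ⟨c, by
      rw [Formula.realize_relabel, Sum.elim_comp_map, Function.comp_id]
      convert hc using 2
      ext x
      exact congrArg f ((pullEquiv g σ).symm_apply_apply x)⟩
  rw [Formula.realize_relabel, Sum.elim_comp_map] at hd
  refine ⟨g.symm ∘ d, ?_⟩
  refine (holds_elim_comp g σ φ id (g.symm ∘ d)).1 ?_
  convert! hd using 2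
  ext x
  exact g.apply_symm_apply _

theorem Exp.pull_mem_ecSmooth (g : M ≃[L] N) {σ : Exp N T₀} (h : σ ∈ ecSmooth N T₀) :
    σ.pull g ∈ ecSmooth M T₀ :=
  ⟨Exp.isECModel_pull g σ.1 h.1, h.2.pullStructure g⟩

theorem oneDiagram_pullStructure (g : M ≃[L] N) (σ : L'.Structure N) {n : ℕ} (b : Fin n → M) :
    oneDiagram (L := L) (pullStructure g σ) b = oneDiagram σ (g ∘ b) := by
  ext φ
  exact and_congr_right fun _ => holds_pullStructure g σ φ b

theorem oneDiagram_pullStructure_symm (g : M ≃[L] N) (σ : L'.Structure M) {n : ℕ} (b : Fin n → M) :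
    oneDiagram (L := L) (pullStructure g.symm σ) (g ∘ b) = oneDiagram σ b := by
  rw [oneDiagram_pullStructure, ← Function.comp_assoc]
  congr 1
  ext j
  exact g.symm_apply_apply _

/-- Isomorphic tuples have the same diagram space. -/
def DiagramSpace.map (g : M ≃[L] N) {n : ℕ} (b : Fin n → M) (d : DiagramSpace T₀ b) :
    DiagramSpace T₀ (g ∘ b) :=
  ⟨d.1, by
    obtain ⟨α, hα, h⟩ := d.2
    exact ⟨α.pull g.symm, Exp.pull_mem_ecSmooth g.symm hα,
      (oneDiagram_pullStructure_symm g α.1 b).trans h⟩⟩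

theorem DiagramSpace.continuous_map (g : M ≃[L] N) {n : ℕ} (b : Fin n → M) :
    Continuous (DiagramSpace.map (T₀ := T₀) g b) := by
  refine continuous_generateFrom_iff.2 ?_
  rintro _ ⟨π, rfl⟩
  refine isOpen_generateFrom_of_mem ⟨π, ?_⟩
  ext d
  constructor
  · rintro ⟨α, hα, hπ, h⟩
    exact ⟨α.pull g, Exp.pull_mem_ecSmooth g hα,
      (exists_realize_pullStructure g α.1 π.type π.formula b).2 hπ,
      (oneDiagram_pullStructure g α.1 b).trans h⟩
  · rintro ⟨α, hα, hπ, h⟩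
    refine ⟨α.pull g.symm, Exp.pull_mem_ecSmooth g.symm hα, ?_,
      (oneDiagram_pullStructure_symm g α.1 b).trans h⟩
    refine (exists_realize_pullStructure g.symm α.1 π.type π.formula (g ∘ b)).2 ?_
    have e : g.symm ∘ g ∘ b = b := by
      ext j
      exact g.symm_apply_apply _
    rw [e]
    exact hπ

/-- The point in question is the preimage of an isolated point under the continuous injection
`DiagramSpace.map g b`, which leaves diagrams unchanged as sets. -/
theorem IsEAtomic.pull (g : M ≃[L] N) {σ : Exp N T₀} (h : IsEAtomic σ) :
    IsEAtomic (σ.pull g) := by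
  obtain ⟨hσ, h⟩ := h
  refine ⟨Exp.pull_mem_ecSmooth g hσ, fun n b => ?_⟩
  convert (h n (g ∘ b)).preimage (DiagramSpace.continuous_map g b) using 1
  ext d
  have e : oneDiagram (L := L) (σ.pull g).1 b = oneDiagram σ.1 (g ∘ b) :=
    oneDiagram_pullStructure g σ.1 b
  constructor
  · rintro rfl
    exact Subtype.ext e
  · intro hd
    exact Subtype.ext ((congrArg Subtype.val hd).trans e.symm)

end Pullback

/-! ### Density of e-atomic expansions and the passage from `Y` to the whole space. -/

section Density

variable {L : FirstOrder.Language.{u, v}} {L' : FirstOrder.Language.{u', v'}}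
  {T₀ : (L.sum L').Theory} {N : Type w} [L.Structure N]

/-- A countable saturated structure is homogeneous. -/
theorem IsCountablySaturated.exists_equiv [Countable N] (hN : IsCountablySaturated L N) {k : ℕ}
    {b b' : Fin k → N} (h : ∀ ξ : L.Formula (Fin k), ξ.Realize b ↔ ξ.Realize b') :
    ∃ g : N ≃[L] N, g ∘ b = b' := by
  have hs : IsPartialElementary L (Set.range fun j => (b j, b' j)) := by
    intro n i hi ξ
    choose r hr using hi
    have := h (ξ.relabel r)
    rw [Formula.realize_relabel, Formula.realize_relabel] at this
    simp only [← hr]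
    exact this
  -- The demands, one for each `a` in `N` and without arguments, force surjectivity.
  obtain ⟨g, hg, hgs, hgQ⟩ := hs.exists_extension hN hN (Set.finite_range _) (ι := N)
    (fun _ => 0) (fun a _ y => y = a)
  have hbij : Function.Bijective g :=
    ⟨fun x y hxy => (hg.eq_iff ⟨x, rfl⟩ ⟨y, rfl⟩).2 hxy, fun y => hgQ y Fin.elim0 ⟨y, rfl⟩⟩
  exact ⟨{ toEquiv := Equiv.ofBijective g hbij
           map_fun' := fun f x => hg.apply_funMap f x
           map_rel' := fun r x => hg.relMap_iff r x }, funext fun j => hgs _ ⟨j, rfl⟩⟩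

theorem holds_congr_freeVars {σ : L'.Structure N} {α : Type*} (φ : (L.sum L').Formula α)
    {v v' : α → N} (h : ∀ a ∈ φ.freeVars, v a = v' a) : Holds σ φ v ↔ Holds σ φ v' :=
  letI := expand (L := L) σ
  φ.realize_congr_freeVars h

/-- An extra index with an arbitrary value gives `r` somewhere to send points outside `F`, even when
`F` is empty. -/
theorem _root_.Set.Finite.exists_fin_retraction {α : Type*} [Nonempty α] {F : Set α}
    (hF : F.Finite) :
    ∃ (k : ℕ) (b : Fin k → α) (r : α → Fin k), ∀ x ∈ F, b (r x) = x := by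
  classical
  obtain ⟨k, b, -, hb⟩ := hF.fin_param
  have h : ∀ x, ∃ j : Fin (k + 1), x ∈ F →
      (Fin.cons (Classical.arbitrary α) b : Fin (k + 1) → α) j = x := by
    intro x
    by_cases hx : x ∈ F
    · rw [← hb] at hx
      obtain ⟨j, rfl⟩ := hx
      exact ⟨j.succ, fun _ => by simp⟩
    · exact ⟨0, fun h => (hx h).elim⟩
  choose r hr using h
  exact ⟨k + 1, _, r, hr⟩

/-- If the existentially closed models share their existential theory and there is an e-atomic
expansion, then the e-atomic expansions are dense among the existentially closed smooth ones. -/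
theorem dense_isEAtomic [Nonempty N] {T : L.Theory} (hT : T.HasQE) (hNT : N ⊨ T) [Countable N]
    (hN : IsCountablySaturated L N)
    (hec : Theory.ECModelsShareExistentialTheory.{max u u', max v v', w} T₀)
    (hex : ∃ α : Exp N T₀, IsEAtomic α) :
    Dense {α : ecSmooth N T₀ | IsEAtomic α.1} := by
  classical
  obtain ⟨β, hβ⟩ := hex
  have hβY : β ∈ ecSmooth N T₀ := hβ.1
  intro σ
  rw [closure_subtype]
  refine Exp.mem_closure fun θ hθ hσ => ?_
  obtain ⟨k, b, r, hbr⟩ := Set.Finite.exists_fin_retraction θ.finite_freeVars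
  have hθb : Holds σ.1.1 θ (b ∘ r) := (holds_congr_freeVars θ hbr).2 hσ
  -- Smoothness of `β` for the `L`-type of `b` together with `θ`. Each finite part is an existential
  -- sentence true in `σ`, hence in `β`; `z` trades `Fin 0` for `Empty` to make it a sentence.
  obtain ⟨b', hb', hθb'⟩ := hβY.2 0 k Fin.elim0
    {ξ | ξ.Realize (Sum.elim Fin.elim0 b)} (θ.relabel (Sum.inr ∘ r)) (hθ.relabel _) (by
      intro s hs
      let z : Fin 0 ⊕ Fin k → Empty ⊕ Fin k := Sum.map Fin.elim0 id
      have hz : ∀ c : Fin k → N, Sum.elim (default : Empty → N) c ∘ z = Sum.elim Fin.elim0 c := by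
        intro c
        ext x
        rcases x with x | x
        · exact x.elim0
        · rfl
      obtain ⟨χ, hχ, hχ'⟩ := exists_isExistential (α := Empty) (L' := L') hT hNT
        (s.image fun ξ => ξ.relabel z) (ψ := θ.relabel (Sum.inr ∘ r)) (hθ.relabel _)
      have h₁ : Holds σ.1.1 χ default := (hχ' _ _).2 ⟨b, by
        simp only [Finset.forall_mem_image, Formula.realize_relabel, hz]
        exact fun ξ hξ => hs hξ, by rw [holds_relabel]; exact hθb⟩
      have h₂ : Holds β.1 χ default :=
        (@hec N N (expand (L := L) σ.1.1) (expand (L := L) β.1) _ _ σ.2.1 hβY.1 χ hχ).1 h₁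
      obtain ⟨c, hc, hcθ⟩ := (hχ' _ _).1 h₂
      simp only [Finset.forall_mem_image, Formula.realize_relabel, hz] at hc
      refine ⟨c, fun ξ hξ => hc hξ, ?_⟩
      rw [holds_relabel] at hcθ ⊢
      exact hcθ)
  have hbb' : ∀ ξ : L.Formula (Fin k), ξ.Realize b → ξ.Realize b' := by
    intro ξ hξ
    have := hb' (ξ.relabel Sum.inr) (by
      rw [Set.mem_ofPred_eq, Formula.realize_relabel]
      exact hξ)
    rwa [Formula.realize_relabel] at this
  obtain ⟨g, hg⟩ := hN.exists_equiv (b := b) (b' := b') fun ξ =>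
    ⟨hbb' ξ, fun h => by_contra fun h' => Formula.realize_not.1
      (hbb' ξ.not (Formula.realize_not.2 h')) h⟩
  have hατ : IsEAtomic (β.pull g) := hβ.pull g
  refine ⟨β.pull g, ⟨⟨β.pull g, hατ.1⟩, hατ, rfl⟩, ?_⟩
  refine (holds_pullStructure g β.1 θ id).2 ?_
  rw [holds_relabel] at hθb'
  refine (holds_congr_freeVars θ fun x hx => ?_).1 hθb'
  change b' (r x) = g x
  rw [← hg]
  exact congrArg g (hbr x hx)

/-- A dense `Gδ` subset of a comeagre subspace is comeagre in the whole space. -/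
theorem _root_.IsGδ.mem_residual_of_subtype {X : Type*} [TopologicalSpace X] {Y S : Set X}
    (hY : Y ∈ residual X) (hd : Dense {y : Y | y.1 ∈ S}) (hG : IsGδ {y : Y | y.1 ∈ S}) :
    S ∈ residual X := by
  obtain ⟨f, hf, hSf⟩ := isGδ_iff_eq_iInter_nat.1 hG
  choose W hW hWf using fun n => isOpen_induced_iff.1 (hf n)
  -- `W n` contains the part of `S` in `Y`, which is dense in `Y`, so `Y ⊆ closure (W n)`.
  have hres : ∀ n, W n ∪ Yᶜ ∈ residual X := by
    intro n
    refine (hW n).union_compl_mem_residual fun y hy => ?_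
    have h := hd ⟨y, hy⟩
    rw [closure_subtype] at h
    refine closure_mono ?_ h
    rintro _ ⟨z, hz, rfl⟩
    rw [hSf] at hz
    have := Set.mem_iInter.1 hz n
    rwa [← hWf n] at this
  filter_upwards [hY, countable_iInter_mem.2 hres] with y hy hyW
  have : (⟨y, hy⟩ : Y) ∈ {y : Y | y.1 ∈ S} := by
    rw [hSf, Set.mem_iInter]
    intro n
    rw [← hWf n]
    exact (Set.mem_iInter.1 hyW n).resolve_right fun h => h hy
  exact this

end Density

end FirstOrder.Language

theorem theorem3p6 {L : FirstOrder.Language.{u, v}} {L' : FirstOrder.Language.{u', v'}}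
    (hL : Countable L.Symbols) (hL' : Finite L'.Symbols)
    (T : L.Theory) (hTcomplete : T.IsComplete) (hTqe : T.HasQE) (hTsmall : T.IsSmall)
    (T₀ : (L.sum L').Theory)
    (hTT₀ : FirstOrder.Language.liftTheory L' T ⊆ T₀)
    (hT₀univ : FirstOrder.Language.IsUniversalModulo T T₀)
    (N : Type w) [L.Structure N] [Nonempty N] (hN : Countable N) (hNT : N ⊨ T)
    (hNsat : FirstOrder.Language.IsCountablySaturated L N)
    (hec : FirstOrder.Language.Theory.ECModelsShareExistentialTheory.{max u u', max v v', w} T₀)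
    (hex : ∃ α : FirstOrder.Language.Exp N T₀, FirstOrder.Language.IsEAtomic α) :
    {α : FirstOrder.Language.Exp N T₀ | FirstOrder.Language.IsEAtomic α} ∈
        residual (FirstOrder.Language.Exp N T₀) ∧
      FirstOrder.Language.ecSmooth N T₀ ∈ residual (FirstOrder.Language.Exp N T₀) ∧
      {α : FirstOrder.Language.Exp N T₀ | FirstOrder.Language.IsEAtomic α} ⊆
        FirstOrder.Language.ecSmooth N T₀ ∧
      Dense {α : FirstOrder.Language.ecSmooth N T₀ | FirstOrder.Language.IsEAtomic α.1} ∧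
      IsGδ {α : FirstOrder.Language.ecSmooth N T₀ | FirstOrder.Language.IsEAtomic α.1} := by
  have hY := FirstOrder.Language.Exp.ecSmooth_mem_residual hL inferInstance hTqe hTsmall hTT₀
    hNT hNsat
  have hd := FirstOrder.Language.dense_isEAtomic hTqe hNT hNsat hec hex
  have hG := FirstOrder.Language.isGδ_isEAtomic (T₀ := T₀) hTqe hNT
  exact ⟨hG.mem_residual_of_subtype hY hd, hY, fun α hα => hα.1, hd, hG⟩
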